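/- **Theorem 1 (ASE gap for random subspaces).** For $d,n$ with $d\ge 1$, let $(\mathbb C^d)^{\otimes n}$ carry the Weyl–Heisenberg displacement operators $D_{\mathbf a}=D_{\mathbf a_1}\otimes\cdots\otimes D_{\mathbf a_n}$, $\mathbf a\in(\mathbb Z_d^2)^n$, where $D_{(a_1,a_2)}=\tau^{a_1a_2}X^{a_1}Z^{a_2}$ for $a_1,a_2\in\{0,\dots,d-1\}$, $\tau=-e^{i\pi/d}$, $X|k\rangle=|k+1 \bmod d\rangle$, $Z|k\rangle=e^{2\pi i k/d}|k\rangle$. The linear stabilizer entropy of a pure state $\psi=|\psi\rangle\langle\psi|$ is $$M(\psi)=1-\frac1{d^n}\sum_{\mathbf a}\bigl|\mathrm{Tr}(D_{\mathbf a}^\dagger\psi)\bigr|^4 .$$ Let $\mathcal H_{d_S}$ and $\mathcal H_{d_B}$ be two such spaces, of total dimensions $d_S\le d_B$ (with possibly different local dimensions and numbers of qudits), and let $M_S$, $M_B$ be their linear stabilizer entropies. For an isometric embedding $\mathcal E:\mathcal H_{d_S}\to\mathcal H_{d_B}$ put $$\Delta M(\mathcal E)=\mathbb E_U\bigl[M_B(\mathcal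 E(U\psi U^\dagger))-M_S(U\psi U^\dagger)\bigr],$$ where $U$ is Haar distributed on $U(d_S)$ and $\psi$ is any fixed pure state of $\mathcal H_{d_S}$. There is a unitarily invariant probability measure on the set of $d_S$-dimensional subspaces of $\mathcal H_{d_B}$. Let $W$ be distributed according to any such measure, and for each $W$ let $\mathcal E_W$ be any isometric embedding with image $W$. Then $\Delta M(\mathcal E_W)$ and $\mathbb E_U[M_B(\mathcal E_W(U\psi U^\dagger))]$ are integrable functions of $W$ and, for all pure states $\psi$ of $\mathcal H_{d_S}$ and $\varphi$ of $\mathcal H_{d_B}$, $$\mathbb E_W\bigl[\Delta M(\mathcal E_W)\bigr]=\mathbb E_{V}\bigl[M_B(V\varphi V^\dagger)\bigr]-\mathbb E_{U}\bigl[M_S(U\psi U^\dagger)\bigr],$$ and equivalently $$\mathbb E_W\,\mathbb E_{U}\bigl[M_B(\mathcal E_W(U\psi U^\dagger))\bigr]=\mathbb E_{V}\bigl[M_B(V\varphi V^\dagger)\bigr],$$ where $U$ and $V$ are Haar distributed on $U(d_S)$ and $U(d_B)$. -/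

import Mathlib

open MeasureTheory

noncomputable section

/-! ### Weyl–Heisenberg operators and stabilizer entropy -/

/-- The Hilbert space `(ℂ^d)^{⊗ n}` of `n` qudits of local dimension `d`, in coordinates with
respect to the computational basis `|k₁ … kₙ⟩`, `kᵢ ∈ ℤ/d`. Its dimension is `d ^ n`. -/
abbrev QuditSpace (d n : ℕ) [NeZero d] : Type := EuclideanSpace ℂ (Fin n → ZMod d)

/-- The clock operator `Z|k⟩ = ω^k |k⟩`, `ω = exp(2πi/d)`. -/
def clock (d : ℕ) [NeZero d] : Matrix (ZMod d) (ZMod d) ℂ :=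
  Matrix.diagonal fun k => Complex.exp (2 * Real.pi * Complex.I / d) ^ k.val

/-- The shift operator `X|k⟩ = |k + 1 mod d⟩`. -/
def shift (d : ℕ) [NeZero d] : Matrix (ZMod d) (ZMod d) ℂ :=
  Matrix.of fun i j => if i = j + 1 then 1 else 0

/-- The single-qudit displacement operator `D_a = τ^{a₁ a₂} X^{a₁} Z^{a₂}` with
`τ = -exp(πi/d)`; the indices are represented by integers in `{0, …, d - 1}`. -/
def displacement (d : ℕ) [NeZero d] (a : ZMod d × ZMod d) : Matrix (ZMod d) (ZMod d) ℂ :=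
  (-Complex.exp (Real.pi * Complex.I / d)) ^ (a.1.val * a.2.val) •
    (shift d ^ a.1.val * clock d ^ a.2.val)

/-- The `n`-qudit displacement operator `D_{a₁} ⊗ ⋯ ⊗ D_{aₙ}`. -/
def multiDisplacement (d n : ℕ) [NeZero d] (a : Fin n → ZMod d × ZMod d) :
    Matrix (Fin n → ZMod d) (Fin n → ZMod d) ℂ :=
  Matrix.of fun i j => ∏ k, displacement d (a k) (i k) (j k)

/-- The operator `|ψ⟩⟨ψ|`. -/
def pureState {d n : ℕ} [NeZero d] (ψ : QuditSpace d n) :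
    Matrix (Fin n → ZMod d) (Fin n → ZMod d) ℂ :=
  Matrix.of fun i j => ψ i * star (ψ j)

/-- `P_a(ρ) = |Tr(D_a† ρ)|² / d^n`. -/
def weylProb {d n : ℕ} [NeZero d] (ρ : Matrix (Fin n → ZMod d) (Fin n → ZMod d) ℂ)
    (a : Fin n → ZMod d × ZMod d) : ℝ :=
  ‖((multiDisplacement d n a).conjTranspose * ρ).trace‖ ^ 2 / (d : ℝ) ^ n

/-- The linear stabilizer entropy (of order two) of the pure state `|ψ⟩⟨ψ|`:
`M(ψ) = 1 - d^n ∑_a P_a(ψ)²`. -/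
def stabEntropy {d n : ℕ} [NeZero d] (ψ : QuditSpace d n) : ℝ :=
  1 - (d : ℝ) ^ n * ∑ a : Fin n → ZMod d × ZMod d, weylProb (pureState ψ) a ^ 2

/-! ### Haar averages -/

section Haar

variable (E : Type*) [NormedAddCommGroup E] [InnerProductSpace ℂ E] [FiniteDimensional ℂ E]
  [CompleteSpace E]

/-- The unitary group of the Hilbert space `E`. -/
abbrev UnitaryOp : Type _ := unitary (E →L[ℂ] E)

instance instCompactSpaceUnitaryOp : CompactSpace (UnitaryOp E) := by
  have : ProperSpace (E →L[ℂ] E) := FiniteDimensional.proper ℂ _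
  refine isCompact_iff_compactSpace.mp (Metric.isCompact_of_isClosed_isBounded ?_ ?_)
  · have : (unitary (E →L[ℂ] E) : Set (E →L[ℂ] E)) =
        {u | star u * u = 1} ∩ {u | u * star u = 1} := by
      ext u; exact Unitary.mem_iff
    rw [this]
    exact (isClosed_eq (by fun_prop) continuous_const).inter
      (isClosed_eq (by fun_prop) continuous_const)
  · refine (Metric.isBounded_closedBall (x := (0 : E →L[ℂ] E)) (r := 1)).subset fun u hu => ?_
    rw [mem_closedBall_zero_iff]
    refine ContinuousLinearMap.opNorm_le_bound _ zero_le_one fun x => ?_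
    rw [one_mul]
    exact (Unitary.norm_map (⟨u, hu⟩ : unitary (E →L[ℂ] E)) x).le

/-- The Haar probability measure on the unitary group. -/
def unitaryHaar : Measure (UnitaryOp E) := Measure.haarMeasure ⊤

variable {E}

/-- The Haar average `𝔼_U[f(Uψ)]`. -/
def haarAverage (f : E → ℝ) (ψ : E) : ℝ :=
  ∫ U : UnitaryOp E, f ((U : E →L[ℂ] E) ψ) ∂(unitaryHaar E)

/-! ### The Grassmannian and its unitary action -/

variable (E) in
/-- The set of `k`-dimensional subspaces of `E`. -/
def SubspacesOfDim (k : ℕ) : Type _ := {W : Submodule ℂ E // Module.finrank ℂ W = k}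

/-- A subspace is identified with its orthogonal projector for the purpose of measurability. -/
instance instMeasurableSpaceSubspaces (k : ℕ) : MeasurableSpace (SubspacesOfDim E k) :=
  MeasurableSpace.comap (fun W => W.1.starProjection) (borel (E →L[ℂ] E))

/-- `U • W = U(W)`. -/
instance instSMulSubspaces (k : ℕ) : SMul (UnitaryOp E) (SubspacesOfDim E k) where
  smul U W := ⟨W.1.map (U : E →L[ℂ] E).toLinearMap,
    (LinearEquiv.finrank_eq (Submodule.equivMapOfInjective _
      (fun _ _ h => (Unitary.linearIsometryEquiv U).injective h) W.1)).symm.trans W.2⟩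

end Haar

/-! ### The stabilizer entropy gap -/

section Gap

variable {dS nS dB nB : ℕ} [NeZero dS] [NeZero dB]

/-- The stabilizer entropy gap `M_B(ℰ(ψ)) - M_S(ψ)` of a state `ψ` of the small system under an
isometric embedding `ℰ` into the big system. -/
def stateGap (ℰ : QuditSpace dS nS →ₗᵢ[ℂ] QuditSpace dB nB) (ψ : QuditSpace dS nS) : ℝ :=
  stabEntropy (ℰ ψ) - stabEntropy ψ

/-- The average stabilizer entropy gap `ΔM(ℰ) = 𝔼_U[M_B(ℰ(Uψ)) - M_S(Uψ)]`, with fiducial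
state `ψ`. -/
def aseGap (ℰ : QuditSpace dS nS →ₗᵢ[ℂ] QuditSpace dB nB) (ψ : QuditSpace dS nS) : ℝ :=
  haarAverage (stateGap ℰ) ψ

/-- The average extrinsic stabilizer entropy `𝔼_U[M_B(ℰ(Uψ))]` of the image of `ℰ`. -/
def extrinsicASE (ℰ : QuditSpace dS nS →ₗᵢ[ℂ] QuditSpace dB nB) (ψ : QuditSpace dS nS) : ℝ :=
  haarAverage (fun φ => stabEntropy (ℰ φ)) ψ

end Gap

end

/-!
The unitary group acts transitively on every sphere, so the Haar average of `f` at `x` depends only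
on `‖x‖`. Replacing a random subspace `W` by `V • W`, with `V` an independent Haar unitary, does not
change its law; up to a reparametrization of `U` it replaces `ℰ_W (U ψ)` by `V (ℰ_W (U ψ))`, and
averaging over `V` first gives the Haar average over the ambient space for every `W` and `U`.

The inner average is integrable in `W`, however irregular the choice of `ℰ_W`, because it is
continuous on the Grassmannian: this compact homogeneous space carries the quotient topology of an
orbit map `V ↦ V • W₀`, along which the average depends on `V` only through `V ∘ ℰ_{W₀}`.
-/

open Measure Module Topology

section GroupAction

theorem compactSpace_of_isPretransitive (G : Type*) {X : Type*} [TopologicalSpace G]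
    [TopologicalSpace X] [CompactSpace G] [SMul G X] [ContinuousSMul G X]
    [MulAction.IsPretransitive G X] : CompactSpace X := by
  rcases isEmpty_or_nonempty X with _ | ⟨⟨x₀⟩⟩
  · infer_instance
  · have hrange : Set.range (fun g : G => g • x₀) = Set.univ :=
      (MulAction.surjective_smul G x₀).range_eq
    exact ⟨hrange ▸ isCompact_range (by fun_prop)⟩

theorem integral_integral_smul {G X F : Type*} [MeasurableSpace G] [MeasurableSpace X] [SMul G X]
    [MeasurableSMul₂ G X] [NormedAddCommGroup F] [NormedSpace ℝ F] (μ : Measure G)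
    [IsProbabilityMeasure μ] (ν : Measure X) [SFinite ν] [SMulInvariantMeasure G X ν] {f : X → F}
    (hf : Integrable f ν) :
    ∫ x, ∫ g, f (g • x) ∂μ ∂ν = ∫ x, f x ∂ν := by
  have hshear : MeasurePreserving (fun p : G × X => (p.1, p.1 • p.2)) (μ.prod ν) (μ.prod ν) :=
    (MeasurePreserving.id μ).skew_product measurable_smul
      (ae_of_all _ fun g => (measurePreserving_smul g ν).map_eq)
  have hsmul : MeasurePreserving (fun p : G × X => p.1 • p.2) (μ.prod ν) ν :=
    measurePreserving_snd.comp hshear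
  calc ∫ x, ∫ g, f (g • x) ∂μ ∂ν = ∫ p : G × X, f (p.1 • p.2) ∂(μ.prod ν) :=
        (integral_prod_symm _ (hsmul.integrable_comp_of_integrable hf)).symm
    _ = ∫ x, f x ∂(map (fun p : G × X => p.1 • p.2) (μ.prod ν)) :=
        (integral_map hsmul.aemeasurable (hsmul.map_eq.symm ▸ hf.aestronglyMeasurable)).symm
    _ = ∫ x, f x ∂ν := by rw [hsmul.map_eq]

variable {G : Type*} [Group G] [TopologicalSpace G] [IsTopologicalGroup G] [MeasurableSpace G]
  [BorelSpace G]

theorem isMulRightInvariant_of_isProbabilityMeasure [LocallyCompactSpace G] (μ : Measure G)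
    [IsHaarMeasure μ] [IsProbabilityMeasure μ] : IsMulRightInvariant μ where
  map_mul_right_eq_self g := by
    have : IsProbabilityMeasure (map (· * g) μ) :=
      isProbabilityMeasure_map (measurable_mul_const g).aemeasurable
    exact isHaarMeasure_eq_of_isProbabilityMeasure _ _

variable (G) in
theorem exists_isProbabilityMeasure_smulInvariantMeasure [CompactSpace G] (X : Type*)
    [MeasurableSpace X] [MulAction G X] [MeasurableSMul G X] [Nonempty X] :
    ∃ ν : Measure X, IsProbabilityMeasure ν ∧ SMulInvariantMeasure G X ν := by
  let x₀ : X := Classical.arbitrary X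
  have horbit : Measurable fun g : G => g • x₀ := measurable_smul_const x₀
  have : IsProbabilityMeasure (haarMeasure (⊤ : TopologicalSpace.PositiveCompacts G)) :=
    ⟨haarMeasure_self⟩
  exact ⟨map (· • x₀) (haarMeasure ⊤), isProbabilityMeasure_map horbit.aemeasurable,
    smulInvariantMeasure_map _ _ (fun g h => mul_smul g h x₀) horbit⟩

end GroupAction

section UnitaryOp

variable {E : Type*} [NormedAddCommGroup E] [InnerProductSpace ℂ E] [FiniteDimensional ℂ E]
  [CompleteSpace E]

instance : SecondCountableTopology (UnitaryOp E) :=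
  have : ProperSpace (E →L[ℂ] E) := FiniteDimensional.proper ℂ _
  inferInstanceAs (SecondCountableTopology (unitary (E →L[ℂ] E) : Set (E →L[ℂ] E)))

instance : IsHaarMeasure (unitaryHaar E) :=
  inferInstanceAs (IsHaarMeasure (haarMeasure ⊤))

instance : IsProbabilityMeasure (unitaryHaar E) :=
  ⟨haarMeasure_self⟩

instance : IsMulRightInvariant (unitaryHaar E) :=
  isMulRightInvariant_of_isProbabilityMeasure _

theorem exists_unitaryOp_comp_eq {H : Type*} [NormedAddCommGroup H] [InnerProductSpace ℂ H]
    (A B : H →ₗᵢ[ℂ] E) :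
    ∃ U : UnitaryOp E, (Unitary.linearIsometryEquiv U).toLinearIsometry.comp A = B := by
  let L : E →ₗᵢ[ℂ] E := (B.comp A.equivRange.symm.toLinearIsometry).extend
  refine ⟨Unitary.linearIsometryEquiv.symm (L.toLinearIsometryEquiv rfl),
    LinearIsometry.ext fun x => ?_⟩
  have hL : L (A x) = B (A.equivRange.symm (A.equivRange x)) :=
    LinearIsometry.extend_apply _ (A.equivRange x)
  simpa using hL

theorem exists_unitaryOp_apply_eq {x y : E} (h : ‖x‖ = ‖y‖) :
    ∃ U : UnitaryOp E, (U : E →L[ℂ] E) x = y := by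
  rcases eq_or_ne x 0 with rfl | hx
  · exact ⟨1, by simpa [eq_comm] using h⟩
  have hy : y ≠ 0 := norm_ne_zero_iff.1 (h ▸ norm_ne_zero_iff.2 hx)
  obtain ⟨U, hU⟩ := exists_unitaryOp_comp_eq
    (LinearIsometry.toSpanSingleton ℂ E (NormedSpace.norm_normalize hx))
    (LinearIsometry.toSpanSingleton ℂ E (NormedSpace.norm_normalize hy))
  have hnormalize : (U : E →L[ℂ] E) (NormedSpace.normalize x) = NormedSpace.normalize y := by
    change Unitary.linearIsometryEquiv U _ = _
    simpa using DFunLike.congr_fun hU 1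
  refine ⟨U, ?_⟩
  calc (U : E →L[ℂ] E) x = ‖x‖ • (U : E →L[ℂ] E) (NormedSpace.normalize x) := by
        rw [← ContinuousLinearMap.map_smul_of_tower, NormedSpace.norm_smul_normalize]
    _ = ‖y‖ • NormedSpace.normalize y := by rw [hnormalize, h]
    _ = y := NormedSpace.norm_smul_normalize y

end UnitaryOp

section HaarAverage

variable {H : Type*} [NormedAddCommGroup H] [InnerProductSpace ℂ H] [FiniteDimensional ℂ H]
  [CompleteSpace H]

theorem haarAverage_sub {f g : H → ℝ} (hf : Continuous f) (hg : Continuous g) (x : H) :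
    haarAverage (fun y => f y - g y) x = haarAverage f x - haarAverage g x := by
  have hint {h : H → ℝ} (hh : Continuous h) :
      Integrable (fun U : UnitaryOp H => h ((U : H →L[ℂ] H) x)) (unitaryHaar H) :=
    Continuous.integrable_of_hasCompactSupport (by fun_prop) (.of_compactSpace _)
  exact integral_sub (hint hf) (hint hg)

theorem haarAverage_comp_unitaryOp (f : H → ℝ) (T : UnitaryOp H) (x : H) :
    haarAverage (fun y => f ((T : H →L[ℂ] H) y)) x = haarAverage f x :=
  integral_mul_left_eq_self (fun U : UnitaryOp H => f ((U : H →L[ℂ] H) x)) T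

theorem haarAverage_unitaryOp_apply (f : H → ℝ) (T : UnitaryOp H) (x : H) :
    haarAverage f ((T : H →L[ℂ] H) x) = haarAverage f x :=
  integral_mul_right_eq_self (fun U : UnitaryOp H => f ((U : H →L[ℂ] H) x)) T

theorem haarAverage_eq_of_norm_eq (f : H → ℝ) {x y : H} (h : ‖x‖ = ‖y‖) :
    haarAverage f x = haarAverage f y := by
  obtain ⟨T, rfl⟩ := exists_unitaryOp_apply_eq h
  exact (haarAverage_unitaryOp_apply f T x).symm

theorem continuous_haarAverage {X : Type*} [TopologicalSpace X] [FirstCountableTopology X]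
    [LocallyCompactSpace X] {f : X → H → ℝ} (hf : Continuous f.uncurry) (x : H) :
    Continuous fun a => haarAverage (f a) x := by
  have hjoint : Continuous fun p : X × UnitaryOp H => f p.1 ((p.2 : H →L[ℂ] H) x) := by
    fun_prop
  simpa only [haarAverage, setIntegral_univ] using
    continuous_parametric_integral_of_continuous (μ := unitaryHaar H)
      (f := fun a (U : UnitaryOp H) => f a ((U : H →L[ℂ] H) x)) hjoint isCompact_univ

variable {E : Type*} [NormedAddCommGroup E] [InnerProductSpace ℂ E]

theorem haarAverage_comp_eq_of_range_eq (f : E → ℝ) {A B : H →ₗᵢ[ℂ] E}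
    (h : LinearMap.range A.toLinearMap = LinearMap.range B.toLinearMap) (x : H) :
    haarAverage (fun y => f (A y)) x = haarAverage (fun y => f (B y)) x := by
  let T : UnitaryOp H := Unitary.linearIsometryEquiv.symm
    ((A.equivRange.trans (LinearIsometryEquiv.ofEq _ _ h)).trans B.equivRange.symm)
  have hT (y : H) : B ((T : H →L[ℂ] H) y) = A y :=
    congrArg Subtype.val (B.equivRange.apply_symm_apply _)
  simpa only [hT] using haarAverage_comp_unitaryOp (fun y => f (B y)) T x

theorem integral_haarAverage_unitaryOp_comp [FiniteDimensional ℂ E] [CompleteSpace E] {f : E → ℝ}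
    (hf : Continuous f) (A : H →ₗᵢ[ℂ] E) {x : H} {y : E} (h : ‖x‖ = ‖y‖) :
    ∫ V : UnitaryOp E, haarAverage (fun z => f ((V : E →L[ℂ] E) (A z))) x ∂(unitaryHaar E) =
      haarAverage f y := by
  have hjoint : Continuous fun p : UnitaryOp E × UnitaryOp H =>
      f ((p.1 : E →L[ℂ] E) (A ((p.2 : H →L[ℂ] H) x))) := by
    fun_prop
  have hnorm (U : UnitaryOp H) : ‖A ((U : H →L[ℂ] H) x)‖ = ‖y‖ := by
    rw [A.norm_map, Unitary.norm_map, h]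
  calc ∫ V : UnitaryOp E, haarAverage (fun z => f ((V : E →L[ℂ] E) (A z))) x ∂(unitaryHaar E)
      = ∫ U : UnitaryOp H, haarAverage f (A ((U : H →L[ℂ] H) x)) ∂(unitaryHaar H) :=
        integral_integral_swap (hjoint.integrable_of_hasCompactSupport (.of_compactSpace _))
    _ = ∫ _ : UnitaryOp H, haarAverage f y ∂(unitaryHaar H) :=
        integral_congr_ae (ae_of_all _ fun U => haarAverage_eq_of_norm_eq f (hnorm U))
    _ = haarAverage f y := by rw [integral_const, probReal_univ, one_smul]

end HaarAverage

namespace SubspacesOfDim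

variable {E : Type*} [NormedAddCommGroup E] [InnerProductSpace ℂ E] {k : ℕ}

theorem nonempty_of_le_finrank (hk : k ≤ finrank ℂ E) : Nonempty (SubspacesOfDim E k) := by
  obtain ⟨v, hv⟩ := exists_linearIndependent_of_le_finrank hk
  exact ⟨⟨Submodule.span ℂ (Set.range v), by simpa using finrank_span_eq_card hv⟩⟩

section Action

variable [CompleteSpace E]

instance : MulAction (UnitaryOp E) (SubspacesOfDim E k) where
  one_smul W := Subtype.ext (Submodule.map_id W.1)
  mul_smul U V W := Subtype.ext
    (Submodule.map_comp (V : E →L[ℂ] E).toLinearMap (U : E →L[ℂ] E).toLinearMap W.1)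

theorem range_unitaryOp_comp {H : Type*} [NormedAddCommGroup H] [InnerProductSpace ℂ H]
    {A : H →ₗᵢ[ℂ] E} {W : SubspacesOfDim E k} (hA : LinearMap.range A.toLinearMap = W.1)
    (U : UnitaryOp E) :
    LinearMap.range ((Unitary.linearIsometryEquiv U).toLinearIsometry.comp A).toLinearMap =
      (U • W).1 :=
  (LinearMap.range_comp A.toLinearMap (U : E →L[ℂ] E).toLinearMap).trans (hA ▸ rfl)

end Action

variable [FiniteDimensional ℂ E]

/-- The topology of the Grassmannian in which subspaces converge when their orthogonal projectors
do. -/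
noncomputable instance : TopologicalSpace (SubspacesOfDim E k) :=
  .induced (fun W => W.1.starProjection) inferInstance

instance : BorelSpace (SubspacesOfDim E k) :=
  ⟨borel_comap.symm⟩

theorem isEmbedding_starProjection :
    IsEmbedding fun W : SubspacesOfDim E k => W.1.starProjection :=
  ⟨⟨rfl⟩, fun _ _ h => Subtype.ext (Submodule.starProjection_inj.1 h)⟩

instance : T2Space (SubspacesOfDim E k) :=
  isEmbedding_starProjection.t2Space

variable [CompleteSpace E]

theorem starProjection_smul (U : UnitaryOp E) (W : SubspacesOfDim E k) :
    (U • W).1.starProjection = (U : E →L[ℂ] E) * W.1.starProjection * star (U : E →L[ℂ] E) :=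
  ContinuousLinearMap.ext
    (Submodule.starProjection_map_apply (Unitary.linearIsometryEquiv U) W.1)

instance : ContinuousSMul (UnitaryOp E) (SubspacesOfDim E k) where
  continuous_smul := by
    have hW : Continuous fun p : UnitaryOp E × SubspacesOfDim E k => p.2.1.starProjection :=
      isEmbedding_starProjection.continuous.comp continuous_snd
    simp only [isEmbedding_starProjection.continuous_iff, Function.comp_def, starProjection_smul]
    fun_prop

instance : MulAction.IsPretransitive (UnitaryOp E) (SubspacesOfDim E k) where
  exists_smul_eq W₁ W₂ := by
    let e : W₁.1 ≃ₗᵢ[ℂ] W₂.1 := (stdOrthonormalBasis ℂ W₁.1).equiv (stdOrthonormalBasis ℂ W₂.1)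
      (finCongr (W₁.2.trans W₂.2.symm))
    obtain ⟨U, hU⟩ := exists_unitaryOp_comp_eq W₁.1.subtypeₗᵢ
      (W₂.1.subtypeₗᵢ.comp e.toLinearIsometry)
    have hsource : LinearMap.range W₁.1.subtypeₗᵢ.toLinearMap = W₁.1 := W₁.1.range_subtype
    have htarget : LinearMap.range (W₂.1.subtypeₗᵢ.comp e.toLinearIsometry).toLinearMap = W₂.1 :=
      (LinearMap.range_comp_of_range_eq_top _ e.range).trans W₂.1.range_subtype
    exact ⟨U, Subtype.ext (by rw [← range_unitaryOp_comp hsource U, hU, htarget])⟩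

instance : CompactSpace (SubspacesOfDim E k) :=
  compactSpace_of_isPretransitive (UnitaryOp E)

end SubspacesOfDim

section RandomSubspace

variable {E H : Type*} [NormedAddCommGroup E] [InnerProductSpace ℂ E] [CompleteSpace E]
  [NormedAddCommGroup H] [InnerProductSpace ℂ H] [FiniteDimensional ℂ H] [CompleteSpace H]
  {k : ℕ} {ℰ : SubspacesOfDim E k → H →ₗᵢ[ℂ] E}

theorem haarAverage_comp_smul (f : E → ℝ) (hℰ : ∀ W, LinearMap.range (ℰ W).toLinearMap = W.1)
    (x : H) (U : UnitaryOp E) (W : SubspacesOfDim E k) :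
    haarAverage (fun y => f (ℰ (U • W) y)) x =
      haarAverage (fun y => f ((U : E →L[ℂ] E) (ℰ W y))) x :=
  haarAverage_comp_eq_of_range_eq f
    ((hℰ _).trans (SubspacesOfDim.range_unitaryOp_comp (hℰ W) U).symm) x

variable [FiniteDimensional ℂ E]

theorem continuous_haarAverage_comp {f : E → ℝ} (hf : Continuous f)
    (hℰ : ∀ W, LinearMap.range (ℰ W).toLinearMap = W.1) (x : H) :
    Continuous fun W => haarAverage (fun y => f (ℰ W y)) x := by
  rcases isEmpty_or_nonempty (SubspacesOfDim E k) with _ | ⟨⟨W₀⟩⟩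
  · exact continuous_of_const fun W => isEmptyElim W
  · have : ProperSpace (E →L[ℂ] E) := FiniteDimensional.proper ℂ _
    -- The choice `W ↦ ℰ W` may be wildly discontinuous, but along the orbit of `W₀` it can be
    -- traded for `U ↦ U ∘ ℰ W₀`.
    have horbit : IsQuotientMap fun U : UnitaryOp E => U • W₀ :=
      .of_surjective_continuous (MulAction.surjective_smul _ W₀) (by fun_prop)
    rw [horbit.continuous_iff]
    simp only [Function.comp_def, haarAverage_comp_smul f hℰ]
    exact continuous_haarAverage (by fun_prop) x

theorem integrable_haarAverage_comp {f : E → ℝ} (hf : Continuous f)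
    (hℰ : ∀ W, LinearMap.range (ℰ W).toLinearMap = W.1) (x : H)
    (ν : Measure (SubspacesOfDim E k)) [IsFiniteMeasure ν] :
    Integrable (fun W => haarAverage (fun y => f (ℰ W y)) x) ν :=
  (continuous_haarAverage_comp hf hℰ x).integrable_of_hasCompactSupport (.of_compactSpace _)

theorem integral_haarAverage_comp {f : E → ℝ} (hf : Continuous f)
    (hℰ : ∀ W, LinearMap.range (ℰ W).toLinearMap = W.1) (ν : Measure (SubspacesOfDim E k))
    [IsProbabilityMeasure ν] [SMulInvariantMeasure (UnitaryOp E) _ ν] {x : H} {y : E}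
    (h : ‖x‖ = ‖y‖) :
    ∫ W, haarAverage (fun z => f (ℰ W z)) x ∂ν = haarAverage f y := by
  rw [← integral_integral_smul (unitaryHaar E) ν (integrable_haarAverage_comp hf hℰ x ν)]
  simp only [haarAverage_comp_smul f hℰ, integral_haarAverage_unitaryOp_comp hf _ h,
    integral_const, probReal_univ, one_smul]

end RandomSubspace

theorem continuous_stabEntropy {d n : ℕ} [NeZero d] :
    Continuous (stabEntropy : QuditSpace d n → ℝ) := by
  have hstate : Continuous (pureState : QuditSpace d n → _) :=
    continuous_matrix fun i j => by
      simp only [pureState, Matrix.of_apply]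
      fun_prop
  unfold stabEntropy weylProb
  fun_prop

theorem finrank_quditSpace (d n : ℕ) [NeZero d] : finrank ℂ (QuditSpace d n) = d ^ n := by
  simp [ZMod.card]

theorem theorem1_general {E H : Type*} [NormedAddCommGroup E] [InnerProductSpace ℂ E]
    [FiniteDimensional ℂ E] [CompleteSpace E] [NormedAddCommGroup H] [InnerProductSpace ℂ H]
    [FiniteDimensional ℂ H] [CompleteSpace H] {k : ℕ} (hk : k ≤ finrank ℂ E)
    {f : E → ℝ} (hf : Continuous f) {g : H → ℝ} (hg : Continuous g) :
    (∃ ν : Measure (SubspacesOfDim E k),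
      IsProbabilityMeasure ν ∧ SMulInvariantMeasure (UnitaryOp E) _ ν) ∧
    ∀ (ν : Measure (SubspacesOfDim E k)) [IsProbabilityMeasure ν]
      [SMulInvariantMeasure (UnitaryOp E) _ ν] (ℰ : SubspacesOfDim E k → H →ₗᵢ[ℂ] E)
      (_ : ∀ W, LinearMap.range (ℰ W).toLinearMap = W.1) (x : H) (y : E) (_ : ‖x‖ = ‖y‖),
      (Integrable (fun W => haarAverage (fun z => f (ℰ W z) - g z) x) ν ∧
        ∫ W, haarAverage (fun z => f (ℰ W z) - g z) x ∂ν = haarAverage f y - haarAverage g x) ∧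
      (Integrable (fun W => haarAverage (fun z => f (ℰ W z)) x) ν ∧
        ∫ W, haarAverage (fun z => f (ℰ W z)) x ∂ν = haarAverage f y) := by
  have := SubspacesOfDim.nonempty_of_le_finrank hk
  refine ⟨exists_isProbabilityMeasure_smulInvariantMeasure _ _, fun ν _ _ ℰ hℰ x y h => ?_⟩
  have hint : Integrable (fun W => haarAverage (fun z => f (ℰ W z)) x) ν :=
    integrable_haarAverage_comp hf hℰ x ν
  have heq : ∫ W, haarAverage (fun z => f (ℰ W z)) x ∂ν = haarAverage f y :=
    integral_haarAverage_comp hf hℰ ν h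
  have hsub (W : SubspacesOfDim E k) : haarAverage (fun z => f (ℰ W z) - g z) x =
      haarAverage (fun z => f (ℰ W z)) x - haarAverage g x :=
    haarAverage_sub (hf.comp (ℰ W).continuous) hg x
  simp only [hsub]
  refine ⟨⟨hint.sub (integrable_const _), ?_⟩, hint, heq⟩
  rw [integral_sub hint (integrable_const _), heq, integral_const, probReal_univ, one_smul]

theorem theorem1 (dS nS dB nB : ℕ) [NeZero dS] [NeZero dB] (hdim : dS ^ nS ≤ dB ^ nB) :
    (∃ ν : Measure (SubspacesOfDim (QuditSpace dB nB) (dS ^ nS)),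
      IsProbabilityMeasure ν ∧ SMulInvariantMeasure (UnitaryOp (QuditSpace dB nB)) _ ν) ∧
    ∀ (ν : Measure (SubspacesOfDim (QuditSpace dB nB) (dS ^ nS))) [IsProbabilityMeasure ν]
      [SMulInvariantMeasure (UnitaryOp (QuditSpace dB nB)) _ ν]
      -- for each subspace, any isometric embedding of the small space onto it
      (ℰ : SubspacesOfDim (QuditSpace dB nB) (dS ^ nS) →
        (QuditSpace dS nS →ₗᵢ[ℂ] QuditSpace dB nB))
      (_ : ∀ W, LinearMap.range (ℰ W).toLinearMap = W.1)
      -- fiducial pure states of the small and of the big system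
      (ψ : QuditSpace dS nS) (_ : ‖ψ‖ = 1) (φ : QuditSpace dB nB) (_ : ‖φ‖ = 1),
      (Integrable (fun W => aseGap (ℰ W) ψ) ν ∧
        ∫ W, aseGap (ℰ W) ψ ∂ν = haarAverage stabEntropy φ - haarAverage stabEntropy ψ) ∧
      (Integrable (fun W => extrinsicASE (ℰ W) ψ) ν ∧
        ∫ W, extrinsicASE (ℰ W) ψ ∂ν = haarAverage stabEntropy φ) := by
  obtain ⟨hexists, haverage⟩ := theorem1_general (hdim.trans_eq (finrank_quditSpace dB nB).symm)
    continuous_stabEntropy (continuous_stabEntropy (d := dS) (n := nS))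
  exact ⟨hexists, fun ν _ _ ℰ hℰ ψ hψ φ hφ => haverage ν ℰ hℰ ψ φ (hψ.trans hφ.symm)⟩
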